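/- Let $\alpha,\beta>0$ and let $X_1,X_2,\dots$ be independent random variables with the Beta$(\alpha,\beta)$ distribution, that is, with density $$f(x)=\frac{\Gamma(\alpha+\beta)}{\Gamma(\alpha)\Gamma(\beta)}\,x^{\alpha-1}(1-x)^{\beta-1},\qquad 0<x<1 .$$ Write $\overline X_n=n^{-1}\sum_{i=1}^n X_i$ and consider the closed-form estimators $$\widehat\alpha_n=\frac{n\overline X_n}{\sum_{i=1}^n X_i\log\frac{X_i}{1-X_i}-\overline X_n\sum_{i=1}^n\log\frac{X_i}{1-X_i}},\qquad \widehat\beta_n=\frac{n(1-\overline X_n)}{\sum_{i=1}^n X_i\log\frac{X_i}{1-X_i}-\overline X_n\sum_{i=1}^n\log\frac{X_i}{1-X_i}} .$$ Let $\psi_1(x)=(\log\Gamma(x))''$ for $x>0$, and put $$\Delta=\frac{1}{\alpha+\beta+1}\begin{pmatrix} v_{11}&v_{12}\\ v_{12}&v_{22}\end{pmatrix},$$ where $$v_{11}=\alpha\big(\alpha(\alpha+\beta+1)+\alpha^2\beta\,[\psi_1(\alpha)+\psi_1(\beta)]-\beta\big),$$ $$v_{12}=\alpha^2\beta+\alpha\beta^2+\alpha^2\beta^2\,[\psi_1(\alpha)+\psi_1(\beta)]-\alpha^2-\beta^2,$$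 $$v_{22}=\beta\big(\beta(\alpha+\beta+1)+\alpha\beta^2\,[\psi_1(\alpha)+\psi_1(\beta)]-\alpha\big).$$ Then $\Delta$ is positive semidefinite and, as $n\to\infty$, $$\sqrt n\begin{pmatrix}\widehat\alpha_n-\alpha\\ \widehat\beta_n-\beta\end{pmatrix}\xrightarrow{\ d\ }\mathcal N(\mathbf 0,\Delta).$$ -/

import Mathlib

/-- The trigamma function `ψ₁(x) = (log Γ(x))''`. -/
noncomputable def trigamma (x : ℝ) : ℝ :=
  deriv (deriv fun t : ℝ => Real.log (Real.Gamma t)) x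

/-- The sample mean of the first `n` terms of `x`. -/
noncomputable def sampleMean (n : ℕ) (x : ℕ → ℝ) : ℝ :=
  (∑ i ∈ Finset.range n, x i) / n

/-- `∑ Xᵢ log (Xᵢ / (1 - Xᵢ)) - X̄ₙ ∑ log (Xᵢ / (1 - Xᵢ))`, sums over the first `n` terms: the
common denominator of the two estimators. -/
noncomputable def betaDenom (n : ℕ) (x : ℕ → ℝ) : ℝ :=
  ∑ i ∈ Finset.range n, x i * Real.log (x i / (1 - x i))
    - sampleMean n x * ∑ i ∈ Finset.range n, Real.log (x i / (1 - x i))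

/-- The closed-form estimator of `α` from the sample `x 0, …, x (n - 1)`. -/
noncomputable def alphaHat (n : ℕ) (x : ℕ → ℝ) : ℝ :=
  n * sampleMean n x / betaDenom n x

/-- The closed-form estimator of `β` from the sample `x 0, …, x (n - 1)`. -/
noncomputable def betaHat (n : ℕ) (x : ℕ → ℝ) : ℝ :=
  n * (1 - sampleMean n x) / betaDenom n x

noncomputable def v11 (α β : ℝ) : ℝ :=
  α * (α * (α + β + 1) + α ^ 2 * β * (trigamma α + trigamma β) - β)

noncomputable def v12 (α β : ℝ) : ℝ :=
  α ^ 2 * β + α * β ^ 2 + α ^ 2 * β ^ 2 * (trigamma α + trigamma β) - α ^ 2 - β ^ 2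

noncomputable def v22 (α β : ℝ) : ℝ :=
  β * (β * (α + β + 1) + α * β ^ 2 * (trigamma α + trigamma β) - α)

/-- The asymptotic covariance matrix `Δ`. -/
noncomputable def asympCov (α β : ℝ) : Matrix (Fin 2) (Fin 2) ℝ :=
  (1 / (α + β + 1)) • !![v11 α β, v12 α β; v12 α β, v22 α β]

/-! Let `ℓ` be the log-odds of a Beta variable `X`, centered at its mean. Then `Cov(X, ℓ) = 1 / (α +
β)`, and the estimators are `X̄` and `1 - X̄` divided by the sample covariance of `X` and `ℓ`, hence
consistent.

Moments: exponential tilting by the log-odds stays in the Beta family, so their cumulant generating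
function is a sum of log-Gammas, with derivatives in digamma and trigamma (`mgf_logOdds`). A factor
`x` only shifts `α` to `α + 1`, and the digamma and trigamma recurrences do the rest.

Limit: by the exact identity `sqrt_smul_estimators_sub`, the error is a continuous function of a
normalized i.i.d. sum of influence vectors and of quantities converging almost surely to constants.
The central limit theorem and Slutsky's theorem conclude. `Δ` is the covariance of the influence
vector, hence positive semidefinite. -/

open MeasureTheory ProbabilityTheory Filter Set
open scoped Topology ENNReal

/-! ### Digamma and trigamma recurrences -/

/-- The digamma function `ψ(x) = (log Γ(x))'` on the reals. -/
noncomputable def realDigamma (x : ℝ) : ℝ := deriv (fun t : ℝ => Real.log (Real.Gamma t)) x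

lemma analyticAt_realGamma {x : ℝ} (hx : 0 < x) : AnalyticAt ℝ Real.Gamma x := by
  have hd : DifferentiableOn ℂ Complex.Gamma {z | 0 < z.re} := fun z hz =>
    (Complex.differentiableAt_Gamma z fun k hk => by
      have : z.re = -(k : ℝ) := by simp [hk]
      have hz' : 0 < z.re := hz
      have : (0 : ℝ) ≤ k := k.cast_nonneg
      linarith).differentiableWithinAt
  have h := (hd.analyticAt ((isOpen_lt continuous_const Complex.continuous_re).mem_nhds
    (show 0 < (x : ℂ).re by simpa using hx))).re_ofReal
  refine h.congr (Eventually.of_forall fun y => ?_)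
  simp [Complex.Gamma_ofReal]

lemma analyticAt_log_realGamma {x : ℝ} (hx : 0 < x) :
    AnalyticAt ℝ (fun t : ℝ => Real.log (Real.Gamma t)) x :=
  (analyticAt_realGamma hx).log (Real.Gamma_pos_of_pos hx)

lemma hasDerivAt_log_realGamma {x : ℝ} (hx : 0 < x) :
    HasDerivAt (fun t : ℝ => Real.log (Real.Gamma t)) (realDigamma x) x :=
  (analyticAt_log_realGamma hx).differentiableAt.hasDerivAt

lemma hasDerivAt_realDigamma {x : ℝ} (hx : 0 < x) :
    HasDerivAt realDigamma (trigamma x) x :=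
  (analyticAt_log_realGamma hx).deriv.differentiableAt.hasDerivAt

lemma realDigamma_add_one {x : ℝ} (hx : 0 < x) :
    realDigamma (x + 1) = realDigamma x + x⁻¹ := by
  have h1 : HasDerivAt (fun t : ℝ => Real.log (Real.Gamma (t + 1))) (realDigamma (x + 1)) x := by
    simpa using (hasDerivAt_log_realGamma (show 0 < x + 1 by linarith)).comp_add_const x 1
  have h2 := (hasDerivAt_log_realGamma hx).add (Real.hasDerivAt_log hx.ne')
  refine h1.unique (h2.congr_of_eventuallyEq ?_)
  filter_upwards [lt_mem_nhds hx] with t ht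
  have := (Real.Gamma_pos_of_pos ht).ne'
  simp only [Pi.add_apply]
  rw [Real.Gamma_add_one ht.ne', Real.log_mul ht.ne' this, add_comm]

lemma trigamma_add_one {x : ℝ} (hx : 0 < x) :
    trigamma (x + 1) = trigamma x - (x ^ 2)⁻¹ := by
  have h1 : HasDerivAt (fun t : ℝ => realDigamma (t + 1)) (trigamma (x + 1)) x := by
    simpa using (hasDerivAt_realDigamma (show 0 < x + 1 by linarith)).comp_add_const x 1
  have h2 := (hasDerivAt_realDigamma hx).add (hasDerivAt_inv hx.ne')
  rw [sub_eq_add_neg]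
  refine h1.unique (h2.congr_of_eventuallyEq ?_)
  filter_upwards [lt_mem_nhds hx] with t ht
  simp [realDigamma_add_one ht]

/-! ### Beta integrals and change of parameters -/

lemma beta_add_one_left {a b : ℝ} (ha : 0 < a) (hb : 0 < b) :
    beta (a + 1) b = a / (a + b) * beta a b := by
  have := (Real.Gamma_pos_of_pos (add_pos ha hb)).ne'
  have h := add_pos ha hb
  rw [beta, beta, show a + 1 + b = (a + b) + 1 by ring, Real.Gamma_add_one ha.ne',
    Real.Gamma_add_one h.ne']
  field_simp

lemma betaPDFReal_nonneg {a b : ℝ} (ha : 0 < a) (hb : 0 < b) (x : ℝ) : 0 ≤ betaPDFReal a b x := by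
  by_cases h : 0 < x ∧ x < 1
  · exact (betaPDFReal_pos h.1 h.2 ha hb).le
  · simp [betaPDFReal, h]

@[fun_prop]
lemma measurable_betaPDF (a b : ℝ) : Measurable (betaPDF a b) :=
  (measurable_betaPDFReal a b).ennreal_ofReal

lemma integrable_betaMeasure_iff {a b : ℝ} (ha : 0 < a) (hb : 0 < b) {g : ℝ → ℝ} :
    Integrable g (betaMeasure a b) ↔ Integrable (fun x => betaPDFReal a b x * g x) := by
  rw [betaMeasure, integrable_withDensity_iff_integrable_smul'
    (measurable_betaPDF a b) (by simp [betaPDF])]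
  simp [betaPDF, ENNReal.toReal_ofReal (betaPDFReal_nonneg ha hb _)]

lemma integral_betaMeasure {a b : ℝ} (ha : 0 < a) (hb : 0 < b) (g : ℝ → ℝ) :
    ∫ x, g x ∂betaMeasure a b = ∫ x, betaPDFReal a b x * g x := by
  rw [betaMeasure, integral_withDensity_eq_integral_toReal_smul
    (measurable_betaPDF a b) (by simp [betaPDF])]
  simp [betaPDF, ENNReal.toReal_ofReal (betaPDFReal_nonneg ha hb _)]

lemma ae_betaMeasure_mem_Ioo (a b : ℝ) : ∀ᵐ x ∂betaMeasure a b, x ∈ Ioo (0 : ℝ) 1 := by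
  rw [betaMeasure, ae_withDensity_iff (measurable_betaPDF a b)]
  refine Eventually.of_forall fun x hx => ?_
  by_contra h
  exact hx (by rw [betaPDF_eq, if_neg (by simpa using h)]; simp)

lemma betaPDFReal_mul_rpow {a b c d : ℝ} (ha : 0 < a) (hb : 0 < b) (hc : 0 < c) (hd : 0 < d)
    (x : ℝ) (f : ℝ → ℝ) (hf : ∀ x ∈ Ioo (0 : ℝ) 1, f x = x ^ (c - a) * (1 - x) ^ (d - b)) :
    betaPDFReal a b x * f x = beta c d / beta a b * betaPDFReal c d x := by
  by_cases h : 0 < x ∧ x < 1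
  · have h1 : 0 < 1 - x := by linarith [h.2]
    rw [betaPDFReal, betaPDFReal, if_pos h, if_pos h, hf x h,
      show c - 1 = (c - a) + (a - 1) by ring, show d - 1 = (d - b) + (b - 1) by ring,
      Real.rpow_add h.1, Real.rpow_add h1]
    have := (beta_pos ha hb).ne'
    have := (beta_pos hc hd).ne'
    field_simp
  · simp [betaPDFReal, h]

/-- Multiplying a beta density by a density ratio changes its parameters. -/
lemma integral_betaMeasure_mul {a b c d : ℝ} (ha : 0 < a) (hb : 0 < b) (hc : 0 < c) (hd : 0 < d)
    {f : ℝ → ℝ} (hf : ∀ x ∈ Ioo (0 : ℝ) 1, f x = x ^ (c - a) * (1 - x) ^ (d - b)) (g : ℝ → ℝ) :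
    ∫ x, f x * g x ∂betaMeasure a b = beta c d / beta a b * ∫ x, g x ∂betaMeasure c d := by
  rw [integral_betaMeasure ha hb, integral_betaMeasure hc hd, ← integral_const_mul]
  congr 1 with x
  rw [← mul_assoc, betaPDFReal_mul_rpow ha hb hc hd x f hf, mul_assoc]

lemma integrable_betaMeasure_of_eq_rpow {a b c d : ℝ} (ha : 0 < a) (hb : 0 < b) (hc : 0 < c)
    (hd : 0 < d) {f : ℝ → ℝ}
    (hf : ∀ x ∈ Ioo (0 : ℝ) 1, f x = x ^ (c - a) * (1 - x) ^ (d - b)) :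
    Integrable f (betaMeasure a b) := by
  have := isProbabilityMeasureBeta hc hd
  have h : Integrable (fun _ : ℝ => (1 : ℝ)) (betaMeasure c d) := integrable_const 1
  rw [integrable_betaMeasure_iff hc hd] at h
  rw [integrable_betaMeasure_iff ha hb]
  refine (h.const_mul (beta c d / beta a b)).congr (Eventually.of_forall fun x => ?_)
  simp [betaPDFReal_mul_rpow ha hb hc hd x f hf]

/-! ### Cumulants and moments of the log-odds -/

/-- The log-odds `log (x / (1 - x))`. -/
noncomputable def logOdds (x : ℝ) : ℝ := Real.log (x / (1 - x))

@[fun_prop]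
lemma measurable_logOdds : Measurable logOdds := by
  unfold logOdds; fun_prop

lemma exp_mul_logOdds {x : ℝ} (hx : x ∈ Ioo (0 : ℝ) 1) (a b t : ℝ) :
    Real.exp (t * logOdds x) = x ^ (a + t - a) * (1 - x) ^ (b - t - b) := by
  have h1 : 0 < 1 - x := by linarith [hx.2]
  rw [logOdds, Real.log_div hx.1.ne' h1.ne', Real.rpow_def_of_pos hx.1, Real.rpow_def_of_pos h1,
    ← Real.exp_add]
  ring_nf

/-- Tilting turns Beta(a, b) into Beta(a + t, b - t); the parameter sum is unchanged, so its Gamma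
factor cancels. -/
lemma mgf_logOdds {a b : ℝ} (ha : 0 < a) (hb : 0 < b) {t : ℝ} (hat : 0 < a + t) (hbt : 0 < b - t) :
    mgf logOdds (betaMeasure a b) t
      = Real.Gamma (a + t) * Real.Gamma (b - t) / (Real.Gamma a * Real.Gamma b) := by
  have := isProbabilityMeasureBeta hat hbt
  have h := integral_betaMeasure_mul ha hb hat hbt
    (fun x hx => exp_mul_logOdds hx a b t) (fun _ => 1)
  simp only [mul_one, integral_const, probReal_univ, smul_eq_mul] at h
  rw [mgf, h, beta, beta]
  have := (Real.Gamma_pos_of_pos (add_pos ha hb)).ne'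
  have := (Real.Gamma_pos_of_pos ha).ne'
  have := (Real.Gamma_pos_of_pos hb).ne'
  rw [show a + t + (b - t) = a + b by ring]
  field_simp

lemma zero_mem_interior_integrableExpSet_logOdds {a b : ℝ} (ha : 0 < a) (hb : 0 < b) :
    0 ∈ interior (integrableExpSet logOdds (betaMeasure a b)) := by
  refine mem_interior.2 ⟨Ioo (-a) b, fun t ht => ?_, isOpen_Ioo, by simpa using ⟨ha, hb⟩⟩
  exact integrable_betaMeasure_of_eq_rpow ha hb (c := a + t) (d := b - t) (by linarith [ht.1])
    (by linarith [ht.2]) (fun x hx => exp_mul_logOdds hx a b t)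

lemma cgf_logOdds_eventuallyEq {a b : ℝ} (ha : 0 < a) (hb : 0 < b) :
    ∀ᶠ t in 𝓝 (0 : ℝ), cgf logOdds (betaMeasure a b) t
      = Real.log (Real.Gamma (a + t)) + Real.log (Real.Gamma (b - t))
        - Real.log (Real.Gamma a * Real.Gamma b) := by
  filter_upwards [Ioo_mem_nhds (show -a < 0 by linarith) hb] with t ht
  have h1 : 0 < a + t := by linarith [ht.1]
  have h2 : 0 < b - t := by linarith [ht.2]
  have := (Real.Gamma_pos_of_pos h1).ne'
  have := (Real.Gamma_pos_of_pos h2).ne'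
  have := (Real.Gamma_pos_of_pos ha).ne'
  have := (Real.Gamma_pos_of_pos hb).ne'
  rw [cgf, mgf_logOdds ha hb h1 h2, Real.log_div (by positivity) (by positivity),
    Real.log_mul (by positivity) (by positivity)]

lemma deriv_cgf_logOdds_eventuallyEq {a b : ℝ} (ha : 0 < a) (hb : 0 < b) :
    deriv (cgf logOdds (betaMeasure a b)) =ᶠ[𝓝 0]
      fun t => realDigamma (a + t) - realDigamma (b - t) := by
  filter_upwards [(cgf_logOdds_eventuallyEq ha hb).eventually_nhds,
    Ioo_mem_nhds (show -a < 0 by linarith) hb] with t h ht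
  refine (HasDerivAt.congr_of_eventuallyEq ?_ h).deriv
  have h1 := (hasDerivAt_log_realGamma (show 0 < a + t by linarith [ht.1])).comp_const_add a t
  have h2 := (hasDerivAt_log_realGamma (show 0 < b - t by linarith [ht.2])).comp_const_sub b t
  simpa [sub_eq_add_neg] using (h1.add h2).sub_const (Real.log (Real.Gamma a * Real.Gamma b))

lemma integral_logOdds {a b : ℝ} (ha : 0 < a) (hb : 0 < b) :
    ∫ x, logOdds x ∂betaMeasure a b = realDigamma a - realDigamma b := by
  have := isProbabilityMeasureBeta ha hb
  have h := deriv_cgf_zero (zero_mem_interior_integrableExpSet_logOdds ha hb)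
  rw [(deriv_cgf_logOdds_eventuallyEq ha hb).eq_of_nhds] at h
  simpa using h.symm

lemma integral_logOdds_sq {a b : ℝ} (ha : 0 < a) (hb : 0 < b) :
    ∫ x, logOdds x ^ 2 ∂betaMeasure a b
      = trigamma a + trigamma b + (realDigamma a - realDigamma b) ^ 2 := by
  have := isProbabilityMeasureBeta ha hb
  have h := iteratedDeriv_two_cgf (zero_mem_interior_integrableExpSet_logOdds ha hb)
  rw [iteratedDeriv_succ, iteratedDeriv_one, (deriv_cgf_logOdds_eventuallyEq ha hb).deriv_eq,
    (deriv_cgf_logOdds_eventuallyEq ha hb).eq_of_nhds] at h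
  have h1 := (hasDerivAt_realDigamma (show 0 < a + 0 by linarith)).comp_const_add a 0
  have h2 := (hasDerivAt_realDigamma (show 0 < b - 0 by linarith)).comp_const_sub b 0
  have h3 := (h1.sub h2).deriv
  simp only [Pi.sub_def] at h3
  rw [h3] at h
  simp at h
  linarith

lemma memLp_logOdds {a b : ℝ} (ha : 0 < a) (hb : 0 < b) (p : NNReal) :
    MemLp logOdds p (betaMeasure a b) :=
  memLp_of_mem_interior_integrableExpSet (zero_mem_interior_integrableExpSet_logOdds ha hb) p

lemma integral_mul_betaMeasure {a b : ℝ} (ha : 0 < a) (hb : 0 < b) (g : ℝ → ℝ) :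
    ∫ x, x * g x ∂betaMeasure a b = a / (a + b) * ∫ x, g x ∂betaMeasure (a + 1) b := by
  rw [integral_betaMeasure_mul ha hb (show 0 < a + 1 by linarith) hb (f := fun x => x)
    (fun x hx => by simp), beta_add_one_left ha hb, mul_div_cancel_right₀ _ (beta_pos ha hb).ne']

lemma integral_sq_mul_betaMeasure {a b : ℝ} (ha : 0 < a) (hb : 0 < b) (g : ℝ → ℝ) :
    ∫ x, x ^ 2 * g x ∂betaMeasure a b
      = a * (a + 1) / ((a + b) * (a + b + 1)) * ∫ x, g x ∂betaMeasure (a + 1 + 1) b := by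
  have h := integral_mul_betaMeasure ha hb (fun x => x * g x)
  rw [integral_mul_betaMeasure (show 0 < a + 1 by linarith) hb] at h
  simp only [← mul_assoc, ← pow_two] at h
  rw [h, div_mul_div_comm, show a + 1 + b = a + b + 1 by ring]

lemma integral_logOdds_sub {a b : ℝ} (ha : 0 < a) (hb : 0 < b) (m : ℝ) :
    ∫ x, (logOdds x - m) ∂betaMeasure a b = realDigamma a - realDigamma b - m := by
  have := isProbabilityMeasureBeta ha hb
  have h1 := (memLp_logOdds ha hb 1).integrable (by simp)
  rw [integral_sub h1 (integrable_const m), integral_logOdds ha hb]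
  simp

/-- The center `m` is free because the lemma is applied at shifted parameters, with `m` still the
mean at the original ones. -/
lemma integral_logOdds_sub_sq {a b : ℝ} (ha : 0 < a) (hb : 0 < b) (m : ℝ) :
    ∫ x, (logOdds x - m) ^ 2 ∂betaMeasure a b
      = trigamma a + trigamma b + (realDigamma a - realDigamma b - m) ^ 2 := by
  have := isProbabilityMeasureBeta ha hb
  have h1 := (memLp_logOdds ha hb 1).integrable (by simp)
  have h2 := (memLp_logOdds ha hb 2).integrable_sq
  have h : ∀ x, (logOdds x - m) ^ 2 = logOdds x ^ 2 + -2 * m * logOdds x + m ^ 2 := fun x => by ring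
  simp_rw [h]
  rw [integral_add (by fun_prop) (by fun_prop), integral_add (by fun_prop) (by fun_prop),
    integral_const_mul, integral_logOdds ha hb,
    integral_logOdds_sq ha hb]
  simp
  ring

lemma memLp_logOdds_sub {a b : ℝ} (ha : 0 < a) (hb : 0 < b) (m : ℝ) (p : NNReal) :
    MemLp (fun x => logOdds x - m) p (betaMeasure a b) := by
  have := isProbabilityMeasureBeta ha hb
  exact (memLp_logOdds ha hb p).sub (memLp_const m)

lemma integrable_pow_mul_logOdds_sub_pow {a b : ℝ} (ha : 0 < a) (hb : 0 < b) (m : ℝ) (j k : ℕ) :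
    Integrable (fun x => x ^ j * (logOdds x - m) ^ k) (betaMeasure a b) := by
  have := isProbabilityMeasureBeta ha hb
  have h : Integrable (fun x => ‖logOdds x - m‖ ^ k) (betaMeasure a b) :=
    (memLp_logOdds_sub ha hb m k).integrable_norm_pow'
  refine h.mono' (Measurable.aestronglyMeasurable (by fun_prop)) ?_
  filter_upwards [ae_betaMeasure_mem_Ioo a b] with x hx
  rw [norm_mul, norm_pow, norm_pow, Real.norm_of_nonneg hx.1.le]
  exact mul_le_of_le_one_left (by positivity) (pow_le_one₀ hx.1.le hx.2.le)

/-- The log-odds centered at their mean under the beta distribution. -/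
noncomputable def centeredLogOdds (α β x : ℝ) : ℝ :=
  logOdds x - (realDigamma α - realDigamma β)

@[fun_prop]
lemma measurable_centeredLogOdds (α β : ℝ) : Measurable (centeredLogOdds α β) := by
  unfold centeredLogOdds; fun_prop

section

variable {α β : ℝ}

lemma integrable_pow_mul_centeredLogOdds_pow (hα : 0 < α) (hβ : 0 < β) (j k : ℕ) :
    Integrable (fun x => x ^ j * centeredLogOdds α β x ^ k) (betaMeasure α β) :=
  integrable_pow_mul_logOdds_sub_pow hα hβ _ j k

lemma integral_centeredLogOdds (hα : 0 < α) (hβ : 0 < β) :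
    ∫ x, centeredLogOdds α β x ∂betaMeasure α β = 0 := by
  simp only [centeredLogOdds]
  rw [integral_logOdds_sub hα hβ, sub_self]

lemma integral_centeredLogOdds_sq (hα : 0 < α) (hβ : 0 < β) :
    ∫ x, centeredLogOdds α β x ^ 2 ∂betaMeasure α β = trigamma α + trigamma β := by
  simp only [centeredLogOdds]
  rw [integral_logOdds_sub_sq hα hβ]
  ring

lemma integral_id_betaMeasure (hα : 0 < α) (hβ : 0 < β) :
    ∫ x, x ∂betaMeasure α β = α / (α + β) := by
  have := isProbabilityMeasureBeta (show 0 < α + 1 by linarith) hβ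
  simpa using integral_mul_betaMeasure hα hβ (fun _ => 1)

lemma integral_sq_betaMeasure (hα : 0 < α) (hβ : 0 < β) :
    ∫ x, x ^ 2 ∂betaMeasure α β = α * (α + 1) / ((α + β) * (α + β + 1)) := by
  have := isProbabilityMeasureBeta (show 0 < α + 1 + 1 by linarith) hβ
  simpa using integral_sq_mul_betaMeasure hα hβ (fun _ => 1)

lemma integral_mul_centeredLogOdds (hα : 0 < α) (hβ : 0 < β) :
    ∫ x, x * centeredLogOdds α β x ∂betaMeasure α β = (α + β)⁻¹ := by
  simp only [centeredLogOdds]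
  rw [integral_mul_betaMeasure hα hβ, integral_logOdds_sub (by linarith) hβ,
    realDigamma_add_one hα]
  field_simp
  ring

lemma integral_mul_centeredLogOdds_sq (hα : 0 < α) (hβ : 0 < β) :
    ∫ x, x * centeredLogOdds α β x ^ 2 ∂betaMeasure α β
      = α / (α + β) * (trigamma α + trigamma β) := by
  simp only [centeredLogOdds]
  rw [integral_mul_betaMeasure hα hβ, integral_logOdds_sub_sq (by linarith) hβ,
    realDigamma_add_one hα, trigamma_add_one hα]
  field_simp
  ring

lemma integral_sq_mul_centeredLogOdds (hα : 0 < α) (hβ : 0 < β) :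
    ∫ x, x ^ 2 * centeredLogOdds α β x ∂betaMeasure α β
      = (2 * α + 1) / ((α + β) * (α + β + 1)) := by
  simp only [centeredLogOdds]
  have h1 : 0 < α + 1 := by linarith
  rw [integral_sq_mul_betaMeasure hα hβ, integral_logOdds_sub (by linarith) hβ,
    realDigamma_add_one h1, realDigamma_add_one hα]
  field_simp
  ring

lemma integral_sq_mul_centeredLogOdds_sq (hα : 0 < α) (hβ : 0 < β) :
    ∫ x, x ^ 2 * centeredLogOdds α β x ^ 2 ∂betaMeasure α β
      = (α * (α + 1) * (trigamma α + trigamma β) + 2) / ((α + β) * (α + β + 1)) := by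
  simp only [centeredLogOdds]
  have h1 : 0 < α + 1 := by linarith
  rw [integral_sq_mul_betaMeasure hα hβ, integral_logOdds_sub_sq (by linarith) hβ,
    realDigamma_add_one h1, realDigamma_add_one hα, trigamma_add_one h1, trigamma_add_one hα]
  field_simp
  ring

/-! ### Variance of the influence functions -/

/-- Linear combinations of the deviations of `x` and of `(x - μ) ℓ(x)` from their means under the
beta distribution, where `μ` is the mean of `x` and `ℓ` are the centered log-odds. -/
noncomputable def betaDeviation (α β p q x : ℝ) : ℝ :=
  p * (x - α / (α + β)) + q * ((x - α / (α + β)) * centeredLogOdds α β x - (α + β)⁻¹)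

@[fun_prop]
lemma measurable_betaDeviation (α β p q : ℝ) : Measurable (betaDeviation α β p q) := by
  unfold betaDeviation; fun_prop

lemma integral_sub_mul_centeredLogOdds (hα : 0 < α) (hβ : 0 < β) (μ : ℝ) :
    Integrable (fun x => (x - μ) * centeredLogOdds α β x) (betaMeasure α β) ∧
      ∫ x, (x - μ) * centeredLogOdds α β x ∂betaMeasure α β = (α + β)⁻¹ := by
  have h01 := integrable_pow_mul_centeredLogOdds_pow hα hβ 0 1
  have h11 := integrable_pow_mul_centeredLogOdds_pow hα hβ 1 1
  simp only [pow_zero, pow_one, one_mul] at h01 h11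
  simp_rw [sub_mul]
  refine ⟨h11.sub (h01.const_mul _), ?_⟩
  rw [integral_sub h11 (h01.const_mul _), integral_const_mul, integral_centeredLogOdds hα hβ,
    integral_mul_centeredLogOdds hα hβ]
  simp

lemma integral_betaDeviation (hα : 0 < α) (hβ : 0 < β) (p q : ℝ) :
    ∫ x, betaDeviation α β p q x ∂betaMeasure α β = 0 := by
  have := isProbabilityMeasureBeta hα hβ
  have h10 := integrable_pow_mul_centeredLogOdds_pow hα hβ 1 0
  simp only [pow_zero, pow_one, mul_one] at h10
  obtain ⟨h, he⟩ := integral_sub_mul_centeredLogOdds hα hβ (α / (α + β))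
  have h' := h10.sub (integrable_const (α / (α + β)))
  have h'' := h.sub (integrable_const (α + β)⁻¹)
  simp only [Pi.sub_def] at h' h''
  simp only [betaDeviation]
  rw [integral_add (h'.const_mul _) (h''.const_mul _), integral_const_mul, integral_const_mul,
    integral_sub h10 (integrable_const _), integral_sub h (integrable_const _), he,
    integral_id_betaMeasure hα hβ]
  simp

/-- `x - μ` is essentially bounded and `ℓ` is square integrable, hence so is their product. -/
lemma memLp_two_betaDeviation (hα : 0 < α) (hβ : 0 < β) (p q : ℝ) :
    MemLp (betaDeviation α β p q) 2 (betaMeasure α β) := by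
  have := isProbabilityMeasureBeta hα hβ
  have hm : MemLp (fun x : ℝ => x - α / (α + β)) ∞ (betaMeasure α β) := by
    refine memLp_top_of_bound (Measurable.aestronglyMeasurable (by fun_prop))
      (1 + |α / (α + β)|) ?_
    filter_upwards [ae_betaMeasure_mem_Ioo α β] with x hx
    refine (norm_sub_le _ _).trans (add_le_add ?_ le_rfl)
    rw [Real.norm_of_nonneg hx.1.le]
    exact hx.2.le
  have hl : MemLp (centeredLogOdds α β) 2 (betaMeasure α β) := memLp_logOdds_sub hα hβ _ 2
  exact ((hm.mono_exponent le_top).const_mul p).add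
    (((hl.mul hm).sub (memLp_const _)).const_mul q)

lemma integral_betaDeviation_sq (hα : 0 < α) (hβ : 0 < β) (p q : ℝ) :
    ∫ x, betaDeviation α β p q x ^ 2 ∂betaMeasure α β
      = (p ^ 2 * (α * β) + 2 * p * q * (β - α)
          + q ^ 2 * (α * β * (trigamma α + trigamma β) + α + β - 1))
        / ((α + β) ^ 2 * (α + β + 1)) := by
  have := isProbabilityMeasureBeta hα hβ
  set μ := α / (α + β) with hμ
  set k := - p * μ - q * (α + β)⁻¹ with hk
  -- `c i j` is the coefficient of `x ^ i * ℓ ^ j` in the expanded square, and `k` is the constant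
  -- term of the deviation.
  let c : Fin 3 → Fin 3 → ℝ := ![![k ^ 2, - 2 * k * q * μ, q ^ 2 * μ ^ 2],
    ![2 * k * p, 2 * k * q - 2 * p * q * μ, - 2 * q ^ 2 * μ], ![p ^ 2, 2 * p * q, q ^ 2]]
  have h : ∀ x, betaDeviation α β p q x ^ 2
      = ∑ i, ∑ j, c i j * (x ^ (i : ℕ) * centeredLogOdds α β x ^ (j : ℕ)) := fun x => by
    simp only [c, Fin.sum_univ_three, betaDeviation, hk]
    simp
    ring
  have hi (i j : Fin 3) := (integrable_pow_mul_centeredLogOdds_pow hα hβ i j).const_mul (c i j)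
  simp_rw [h]
  rw [integral_finsetSum _ fun i _ => integrable_finsetSum _ fun j _ => hi i j]
  simp_rw [integral_finsetSum _ fun j _ => hi _ j, integral_const_mul, Fin.sum_univ_three]
  simp only [c, Fin.val_zero, Fin.val_one, Fin.val_two, pow_zero, pow_one, one_mul, mul_one,
    Matrix.cons_val, integral_const, probReal_univ, one_smul]
  rw [integral_id_betaMeasure hα hβ, integral_sq_betaMeasure hα hβ, integral_centeredLogOdds hα hβ,
    integral_mul_centeredLogOdds hα hβ, integral_sq_mul_centeredLogOdds hα hβ,
    integral_centeredLogOdds_sq hα hβ, integral_mul_centeredLogOdds_sq hα hβ,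
    integral_sq_mul_centeredLogOdds_sq hα hβ, hk, hμ]
  field_simp
  ring

end

open scoped Matrix in
lemma dotProduct_asympCov_mulVec {α β : ℝ} (hα : 0 < α) (hβ : 0 < β) (t : Fin 2 → ℝ) :
    t ⬝ᵥ asympCov α β *ᵥ t = ∫ x, betaDeviation α β ((α + β) * (t 0 - t 1))
      (-(α + β) * (α * t 0 + β * t 1)) x ^ 2 ∂betaMeasure α β := by
  rw [integral_betaDeviation_sq hα hβ]
  simp only [asympCov, v11, v12, v22, Matrix.smul_mulVec, dotProduct_smul]
  simp [Matrix.mulVec, dotProduct, Fin.sum_univ_two]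
  field_simp
  ring

lemma posSemidef_asympCov {α β : ℝ} (hα : 0 < α) (hβ : 0 < β) : (asympCov α β).PosSemidef := by
  refine Matrix.PosSemidef.of_dotProduct_mulVec_nonneg ?_ fun t => ?_
  · ext i j
    fin_cases i <;> fin_cases j <;> simp [asympCov]
  · rw [star_trivial, dotProduct_asympCov_mulVec hα hβ]
    positivity

/-! ### Multivariate central limit theorem -/

open scoped Matrix RealInnerProductSpace in
/-- Multivariate central limit theorem for centered random vectors. -/
theorem tendstoInDistribution_inv_sqrt_smul_sum_multivariateGaussian {Ω ι : Type*}
    [MeasurableSpace Ω] [Fintype ι] [DecidableEq ι] {P : Measure Ω} [IsProbabilityMeasure P]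
    {Y : ℕ → Ω → EuclideanSpace ℝ ι} {S : Matrix ι ι ℝ} (hS : S.PosSemidef)
    (hindep : iIndepFun Y P) (hident : ∀ i, IdentDistrib (Y i) (Y 0) P P)
    (hmem : ∀ t : EuclideanSpace ℝ ι, MemLp (fun ω => ⟪Y 0 ω, t⟫) 2 P)
    (hmean : ∀ t : EuclideanSpace ℝ ι, ∫ ω, ⟪Y 0 ω, t⟫ ∂P = 0)
    (hcov : ∀ t : EuclideanSpace ℝ ι, ∫ ω, ⟪Y 0 ω, t⟫ ^ 2 ∂P = t ⬝ᵥ S *ᵥ t) :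
    TendstoInDistribution (fun (n : ℕ) ω => (√(n : ℝ))⁻¹ • ∑ k ∈ Finset.range n, Y k ω) atTop id
      (fun _ => P) (multivariateGaussian 0 S) where
  forall_aemeasurable n := by
    have := fun i => (hident i).aemeasurable_fst
    fun_prop
  tendsto := by
    have hm (n : ℕ) : AEMeasurable (fun ω => (√(n : ℝ))⁻¹ • ∑ k ∈ Finset.range n, Y k ω) P := by
      have := fun i => (hident i).aemeasurable_fst
      fun_prop
    refine ProbabilityMeasure.tendsto_iff_tendsto_charFun.2 fun t => ?_
    have hgm : Measurable fun y : EuclideanSpace ℝ ι => ⟪y, t⟫ := by fun_prop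
    have hclt := tendstoInDistribution_inv_sqrt_mul_sum_sub (X := fun k ω => ⟪Y k ω, t⟫)
      (P' := gaussianReal 0 Var[fun ω => ⟪Y 0 ω, t⟫; P].toNNReal) HasLaw.id (hmem t)
      (hindep.comp _ fun _ => hgm) (fun i => (hident i).comp hgm)
    have hvar : Var[fun ω => ⟪Y 0 ω, t⟫; P] = t ⬝ᵥ S *ᵥ t := by
      rw [variance_of_integral_eq_zero (hmem t).aestronglyMeasurable.aemeasurable (hmean t), hcov]
    -- Cramér–Wold: the characteristic function of the vector at `t` is that of its projection on
    -- `t` at `1`.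
    have h := ProbabilityMeasure.tendsto_iff_tendsto_charFun.1 hclt.tendsto 1
    simp only [hmean, mul_zero, sub_zero, ProbabilityMeasure.coe_mk, Measure.map_id,
      charFun_gaussianReal, hvar] at h
    simp only [ProbabilityMeasure.coe_mk, Measure.map_id, charFun_multivariateGaussian hS]
    have hnn : 0 ≤ t ⬝ᵥ S *ᵥ t := by simpa using hS.dotProduct_mulVec_nonneg t.ofLp
    convert h using 2 with n
    · rw [charFun_apply, charFun_apply, integral_map (hm n) (by fun_prop),
        integral_map _ (by fun_prop)]
      · simp [inner_smul_left, sum_inner]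
      · simpa [hmean] using hclt.forall_aemeasurable n
    · simp [Real.coe_toNNReal _ hnn]

/-! ### Exact form of the estimation error -/

/-- The rescaled influence vector of the pair of estimators. -/
noncomputable def betaInfluence (α β x : ℝ) : EuclideanSpace ℝ (Fin 2) :=
  !₂[betaDeviation α β (α + β) (-(α + β) * α) x, betaDeviation α β (-(α + β)) (-(α + β) * β) x]

@[fun_prop]
lemma measurable_betaInfluence (α β : ℝ) : Measurable (betaInfluence α β) := by
  refine (WithLp.measurable_toLp 2 (Fin 2 → ℝ)).comp (measurable_pi_lambda _ fun i => ?_)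
  fin_cases i
  · exact measurable_betaDeviation _ _ _ _
  · exact measurable_betaDeviation _ _ _ _

open scoped RealInnerProductSpace in
lemma inner_betaInfluence (α β x : ℝ) (t : EuclideanSpace ℝ (Fin 2)) :
    ⟪betaInfluence α β x, t⟫ = betaDeviation α β ((α + β) * (t 0 - t 1))
      (-(α + β) * (α * t 0 + β * t 1)) x := by
  simp [betaInfluence, PiLp.inner_apply, Fin.sum_univ_two, betaDeviation]
  ring

/-- The map expressing the normalized estimation error through the normalized sum of the influence
vectors `u`, the inverse `r` of the sample covariance, and the mean `τ` of the centered log-odds. -/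
noncomputable def betaErrorMap (α β : ℝ) (z : EuclideanSpace ℝ (Fin 2) × ℝ × ℝ) :
    EuclideanSpace ℝ (Fin 2) :=
  (z.2.1 / (α + β)) •
    (z.1 + (z.2.2 * (β * z.1 0 - α * z.1 1) / (α + β)) • (!₂[α, β] : EuclideanSpace ℝ (Fin 2)))

lemma continuous_betaErrorMap (α β : ℝ) : Continuous (betaErrorMap α β) := by
  unfold betaErrorMap; fun_prop

lemma betaErrorMap_limit {α β : ℝ} (h : α + β ≠ 0) (u : EuclideanSpace ℝ (Fin 2)) :
    betaErrorMap α β (u, α + β, 0) = u := by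
  simp [betaErrorMap, h]

lemma sum_betaDeviation (α β p q : ℝ) (n : ℕ) (x : ℕ → ℝ) :
    ∑ i ∈ Finset.range n, betaDeviation α β p q (x i)
      = p * (∑ i ∈ Finset.range n, x i - n * (α / (α + β)))
        + q * (∑ i ∈ Finset.range n, x i * centeredLogOdds α β (x i)
          - α / (α + β) * ∑ i ∈ Finset.range n, centeredLogOdds α β (x i) - n * (α + β)⁻¹) := by
  simp only [betaDeviation, Finset.sum_add_distrib, ← Finset.mul_sum, Finset.sum_sub_distrib,
    sub_mul, Finset.sum_const, Finset.card_range, nsmul_eq_mul]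

lemma betaDenom_eq (α β : ℝ) {n : ℕ} (hn : n ≠ 0) (x : ℕ → ℝ) :
    betaDenom n x = ∑ i ∈ Finset.range n, x i * centeredLogOdds α β (x i)
      - sampleMean n x * ∑ i ∈ Finset.range n, centeredLogOdds α β (x i) := by
  have hn' : (n : ℝ) ≠ 0 := Nat.cast_ne_zero.2 hn
  simp only [betaDenom, centeredLogOdds, logOdds, mul_sub, Finset.sum_sub_distrib,
    ← Finset.sum_mul, Finset.sum_const, Finset.card_range, nsmul_eq_mul, sampleMean]
  field_simp
  ring

/-- No Taylor remainder occurs. In `β * z.1 0 - α * z.1 1` the log-odds terms cancel, leaving `(α +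
β) ^ 2 * √n * (X̄ - μ)`; times `τ`, this corrects for the influence vectors using `μ` instead of
`X̄`. -/
lemma sqrt_smul_estimators_sub {α β : ℝ} (hα : 0 < α) (hβ : 0 < β) {n : ℕ} (hn : n ≠ 0)
    {x : ℕ → ℝ} (hd : betaDenom n x ≠ 0) :
    √(n : ℝ) • (!₂[alphaHat n x - α, betaHat n x - β] : EuclideanSpace ℝ (Fin 2))
      = betaErrorMap α β ((√(n : ℝ))⁻¹ • ∑ i ∈ Finset.range n, betaInfluence α β (x i),
          n / betaDenom n x, (∑ i ∈ Finset.range n, centeredLogOdds α β (x i)) / n) := by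
  have hn' : (n : ℝ) ≠ 0 := Nat.cast_ne_zero.2 hn
  have hs : √(n : ℝ) ≠ 0 := Real.sqrt_ne_zero'.2 (by positivity)
  have hab : α + β ≠ 0 := by positivity
  obtain ⟨A, hA⟩ : ∃ A, A = ∑ i ∈ Finset.range n, x i := ⟨_, rfl⟩
  obtain ⟨B, hB⟩ : ∃ B, B = ∑ i ∈ Finset.range n, centeredLogOdds α β (x i) := ⟨_, rfl⟩
  obtain ⟨D, hD⟩ : ∃ D, D = ∑ i ∈ Finset.range n, x i * centeredLogOdds α β (x i) := ⟨_, rfl⟩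
  have hden := betaDenom_eq α β hn x
  rw [sampleMean, ← hA, ← hB, ← hD] at hden
  have hsq : √(n : ℝ) ^ 2 = n := Real.sq_sqrt (by positivity)
  -- In this form both sides of the identity are linear in `√n`.
  have hS : (√(n : ℝ))⁻¹ = √(n : ℝ) / n := by
    field_simp
    exact hsq.symm
  have hDe : D = betaDenom n x + A * B / n := by rw [hden]; ring
  ext i
  fin_cases i
  · simp [betaErrorMap, betaInfluence, sum_betaDeviation, alphaHat, sampleMean, ← hA, ← hB, ← hD, hS]
    rw [hDe]
    field_simp
    ring
  · simp [betaErrorMap, betaInfluence, sum_betaDeviation, betaHat, sampleMean, ← hA, ← hB, ← hD, hS]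
    rw [hDe]
    field_simp
    ring

/-! ### Almost sure limits and the limit law -/

section

variable {Ω : Type*} [MeasurableSpace Ω] {P : Measure Ω} {α β : ℝ}
  {X : ℕ → Ω → ℝ}

lemma ae_tendsto_mean_comp (hindep : iIndepFun X P)
    (hlaw : ∀ i, HasLaw (X i) (betaMeasure α β) P) {f : ℝ → ℝ} (hf : Measurable f)
    (hint : Integrable f (betaMeasure α β)) :
    ∀ᵐ ω ∂P, Tendsto (fun n : ℕ => (∑ i ∈ Finset.range n, f (X i ω)) / n) atTop
      (𝓝 (∫ x, f x ∂betaMeasure α β)) := by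
  have hid (i : ℕ) : IdentDistrib (X i) (X 0) P P :=
    ⟨(hlaw i).aemeasurable, (hlaw 0).aemeasurable, (hlaw i).map_eq.trans (hlaw 0).map_eq.symm⟩
  have h := strong_law_ae_real (fun i ω => f (X i ω)) (μ := P)
    (((hlaw 0).map_eq ▸ hint).comp_aemeasurable (hlaw 0).aemeasurable)
    (fun i j hij => (hindep.indepFun hij).comp hf hf) (fun i => (hid i).comp hf)
  have he : ∫ ω, f (X 0 ω) ∂P = ∫ x, f x ∂betaMeasure α β :=
    (hlaw 0).integral_comp hint.aestronglyMeasurable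
  simpa only [he] using h

lemma ae_tendsto_div_betaDenom (hα : 0 < α) (hβ : 0 < β)
    (hindep : iIndepFun X P) (hlaw : ∀ i, HasLaw (X i) (betaMeasure α β) P) :
    ∀ᵐ ω ∂P, Tendsto (fun n : ℕ => ((n : ℝ) / betaDenom n (fun i => X i ω),
      (∑ i ∈ Finset.range n, centeredLogOdds α β (X i ω)) / n)) atTop (𝓝 (α + β, 0)) := by
  have h10 := integrable_pow_mul_centeredLogOdds_pow hα hβ 1 0
  have h01 := integrable_pow_mul_centeredLogOdds_pow hα hβ 0 1
  have h11 := integrable_pow_mul_centeredLogOdds_pow hα hβ 1 1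
  simp only [pow_zero, pow_one, one_mul, mul_one] at h10 h01 h11
  filter_upwards [ae_tendsto_mean_comp hindep hlaw (by fun_prop) h10,
    ae_tendsto_mean_comp hindep hlaw (by fun_prop) h01,
    ae_tendsto_mean_comp hindep hlaw (by fun_prop) h11] with ω hA hB hD
  rw [integral_centeredLogOdds hα hβ] at hB
  rw [integral_mul_centeredLogOdds hα hβ] at hD
  refine Tendsto.prodMk_nhds ?_ hB
  -- The sample covariance tends to `(α + β)⁻¹`, which is nonzero, so its inverse converges.
  have h := (hD.sub (hA.mul hB)).inv₀ (by simp; positivity)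
  simp only [mul_zero, sub_zero, inv_inv] at h
  refine h.congr' ?_
  filter_upwards [eventually_ne_atTop 0] with n hn
  rw [betaDenom_eq α β hn, sampleMean, mul_div_assoc', ← sub_div, inv_div]

lemma tendstoInDistribution_betaInfluence [IsProbabilityMeasure P] (hα : 0 < α) (hβ : 0 < β)
    (hindep : iIndepFun X P) (hlaw : ∀ i, HasLaw (X i) (betaMeasure α β) P) :
    TendstoInDistribution
      (fun (n : ℕ) ω => (√(n : ℝ))⁻¹ • ∑ k ∈ Finset.range n, betaInfluence α β (X k ω)) atTop id
      (fun _ => P) (multivariateGaussian 0 (asympCov α β)) := by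
  have hid (i : ℕ) : IdentDistrib (X i) (X 0) P P :=
    ⟨(hlaw i).aemeasurable, (hlaw 0).aemeasurable, (hlaw i).map_eq.trans (hlaw 0).map_eq.symm⟩
  refine tendstoInDistribution_inv_sqrt_smul_sum_multivariateGaussian
    (Y := fun k ω => betaInfluence α β (X k ω)) (posSemidef_asympCov hα hβ)
    (hindep.comp _ fun _ => measurable_betaInfluence α β)
    (fun i => (hid i).comp (measurable_betaInfluence α β)) (fun t => ?_) (fun t => ?_) (fun t => ?_)
  · simp only [inner_betaInfluence]
    exact ((hlaw 0).map_eq ▸ memLp_two_betaDeviation hα hβ _ _).comp_of_map (hlaw 0).aemeasurable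
  · simp only [inner_betaInfluence]
    exact ((hlaw 0).integral_comp (Measurable.aestronglyMeasurable (by fun_prop))).trans
      (integral_betaDeviation hα hβ _ _)
  · simp only [inner_betaInfluence]
    rw [dotProduct_asympCov_mulVec hα hβ]
    exact (hlaw 0).integral_comp
      (f := fun x => betaDeviation α β _ _ x ^ 2) (Measurable.aestronglyMeasurable (by fun_prop))

end

theorem mainTheorem4 {Ω : Type*} [MeasurableSpace Ω] (P : MeasureTheory.Measure Ω)
    [MeasureTheory.IsProbabilityMeasure P] (α β : ℝ) (hα : 0 < α) (hβ : 0 < β)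
    (X : ℕ → Ω → ℝ) (hindep : ProbabilityTheory.iIndepFun X P)
    (hlaw : ∀ i, ProbabilityTheory.HasLaw (X i) (ProbabilityTheory.betaMeasure α β) P) :
    (asympCov α β).PosSemidef ∧
    MeasureTheory.TendstoInDistribution
      (fun (n : ℕ) (ω : Ω) => Real.sqrt n •
        !₂[alphaHat n (fun i => X i ω) - α, betaHat n (fun i => X i ω) - β])
      Filter.atTop id (fun _ => P)
      (ProbabilityTheory.multivariateGaussian (0 : EuclideanSpace ℝ (Fin 2)) (asympCov α β)) := by
  refine ⟨posSemidef_asympCov hα hβ, ?_⟩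
  have hX (i : ℕ) : AEMeasurable (X i) P := (hlaw i).aemeasurable
  have hlim := ae_tendsto_div_betaDenom hα hβ hindep hlaw
  have hden (n : ℕ) : AEMeasurable (fun ω => betaDenom n (fun i => X i ω)) P := by
    unfold betaDenom sampleMean; fun_prop
  have hY (n : ℕ) : AEMeasurable (fun ω => ((n : ℝ) / betaDenom n (fun i => X i ω),
      (∑ i ∈ Finset.range n, centeredLogOdds α β (X i ω)) / n)) P := by fun_prop
  have hU := tendstoInDistribution_betaInfluence hα hβ hindep hlaw
  -- Slutsky: at the limit values `α + β` and `0` the error map is the identity in the influence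
  -- sum.
  have hS := hU.continuous_comp_prodMk_of_tendstoInMeasure_const (continuous_betaErrorMap α β)
    (tendstoInMeasure_of_tendsto_ae (fun n => (hY n).aestronglyMeasurable) hlim) hY
  simp only [betaErrorMap_limit (add_pos hα hβ).ne'] at hS
  have hE (n : ℕ) : AEMeasurable (fun ω => √(n : ℝ) •
      (!₂[alphaHat n (fun i => X i ω) - α, betaHat n (fun i => X i ω) - β] :
        EuclideanSpace ℝ (Fin 2))) P := by
    refine AEMeasurable.const_smul ?_ (√(n : ℝ))
    refine (WithLp.measurable_toLp 2 (Fin 2 → ℝ)).comp_aemeasurable (aemeasurable_pi_lambda _ ?_)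
    intro i
    fin_cases i
    · change AEMeasurable (fun ω => alphaHat n (fun i => X i ω) - α) P
      unfold alphaHat sampleMean; fun_prop
    · change AEMeasurable (fun ω => betaHat n (fun i => X i ω) - β) P
      unfold betaHat sampleMean; fun_prop
  refine tendstoInDistribution_of_tendstoInMeasure_sub _ _ hS ?_ hE
  refine tendstoInMeasure_of_tendsto_ae
    (fun n => ((hE n).sub (hS.forall_aemeasurable n)).aestronglyMeasurable) ?_
  filter_upwards [hlim] with ω hω
  -- The limit `α + β` is nonzero and division by zero gives `0`, so eventually the denominator is
  -- nonzero and the exact identity applies.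
  have hne : ∀ᶠ n : ℕ in atTop, (n : ℝ) / betaDenom n (fun i => X i ω) ≠ 0 :=
    ((continuous_fst.tendsto _).comp hω).eventually_ne (add_pos hα hβ).ne'
  refine tendsto_const_nhds.congr' ?_
  filter_upwards [hne] with n hn
  have hn' : n ≠ 0 := by rintro rfl; simp at hn
  have hd : betaDenom n (fun i => X i ω) ≠ 0 := fun h => hn (by rw [h, div_zero])
  simp only [Pi.sub_apply, Pi.zero_apply]
  rw [sqrt_smul_estimators_sub hα hβ hn' hd, sub_self]
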